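/- Let $d\ge 2$ be an integer. For a finite set $C\subset\mathbb Z^d$ let $$\Theta_d(C)=\{(x,y)\in\mathbb Z^d\times\mathbb Z^d:\ |x-y|=1,\ x\in C,\ y\notin C\}$$ be its edge boundary, where $|\cdot|$ is the Euclidean norm, and for $n\in\mathbb N$ let $$EIP^d(n)=\min\{\#\Theta_d(C):\ C\subset\mathbb Z^d,\ \#C=n\}.$$ A finite set $C\subset\mathbb Z^d$ is called an $EIP^d$ minimizer if it is empty or if $\#\Theta_d(C)=EIP^d(\#C)$. Let $\ell$ and $p$ be nonnegative integers with $p\le\lfloor \ell^{2^{1-d}}\rfloor$. Then $$P_{\ell,d,p}=\{1,\ldots,\ell-p\}\times\{1,\ldots,\ell\}^{d-1}$$ (the empty set if $\ell=p$) is an $EIP^d$ minimizer. -/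

import Mathlib

/-- The edge boundary `Θ_d(C)` of `C ⊆ ℤ^d`: ordered pairs `(x, y)` of lattice points with
`x ∈ C`, `y ∉ C` and Euclidean distance `|x - y| = 1` (written as `|x - y|² = 1`). -/
def edgeBoundary {d : ℕ} (C : Set (Fin d → ℤ)) : Set ((Fin d → ℤ) × (Fin d → ℤ)) :=
  {q | ∑ i, (q.1 i - q.2 i) ^ 2 = 1 ∧ q.1 ∈ C ∧ q.2 ∉ C}

/-- A finite configuration has a finite edge boundary, so that the cardinality below is the
true one. -/
theorem edgeBoundary_finite {d : ℕ} (C : Finset (Fin d → ℤ)) :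
    (edgeBoundary (C : Set (Fin d → ℤ))).Finite := by
  have h : ((fun q : (Fin d → ℤ) × (Fin d → ℤ) => (q.1, q.1 - q.2)) ''
      edgeBoundary (C : Set (Fin d → ℤ))).Finite := by
    refine ((C.finite_toSet).prod
      (Set.finite_Icc (fun _ : Fin d => (-1 : ℤ)) (fun _ => 1))).subset ?_
    rintro _ ⟨⟨x, y⟩, ⟨h1, hx, -⟩, rfl⟩
    have key : ∀ i, (x i - y i) ^ 2 ≤ 1 := fun i => by
      rw [← h1]
      exact Finset.single_le_sum (f := fun i => (x i - y i) ^ 2)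
        (fun j _ => sq_nonneg _) (Finset.mem_univ i)
    exact ⟨hx, fun i => (abs_le.1 ((sq_le_one_iff_abs_le_one _).1 (key i))).1,
      fun i => (abs_le.1 ((sq_le_one_iff_abs_le_one _).1 (key i))).2⟩
  refine Set.Finite.of_finite_image h ?_
  rintro ⟨x, y⟩ - ⟨x', y'⟩ - he
  obtain ⟨h1, h2⟩ := Prod.ext_iff.1 he
  dsimp only at h1 h2
  subst h1
  exact Prod.ext rfl (sub_right_injective h2)

/-- The edge perimeter `#Θ_d(C)` of a finite configuration `C`. -/
noncomputable def edgePerimeter {d : ℕ} (C : Finset (Fin d → ℤ)) : ℕ :=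
  (edgeBoundary (C : Set (Fin d → ℤ))).ncard

/-- `EIP^d(n)`: the minimal edge perimeter among the configurations of `n` points of `ℤ^d`. -/
noncomputable def EIP (d n : ℕ) : ℕ :=
  sInf {m | ∃ C : Finset (Fin d → ℤ), C.card = n ∧ edgePerimeter C = m}

/-- `C` is an `EIP^d` minimizer; by convention the empty configuration is one. -/
def IsEIPMinimizer {d : ℕ} (C : Finset (Fin d → ℤ)) : Prop :=
  C = ∅ ∨ edgePerimeter C = EIP d C.card

/-- `h_{ℓ,d} = ℓ^(2^(1-d))`. -/
noncomputable def hParam (ℓ d : ℕ) : ℝ :=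
  (ℓ : ℝ) ^ ((2 : ℝ) ^ (1 - (d : ℝ)))

/-- The box `{1,…,ℓ-p} × {1,…,ℓ}^(d-1)`; coordinates are indexed from `0`. -/
noncomputable def boxP (ℓ d p : ℕ) : Finset (Fin d → ℤ) :=
  Fintype.piFinset fun i : Fin d => Finset.Icc 1 (if (i : ℕ) = 0 then (ℓ : ℤ) - p else ℓ)

/-!
Call a box with side lengths differing by at most one balanced. Growing balanced boxes one facet at
a time, and filling each new facet in the same way one dimension lower, gives for every `n` a
configuration of `n` points; half its edge perimeter is `cascade d n`.

No configuration does better. The half edge perimeter is at least the sum of the cardinalities of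
the coordinate projections. In a direction with the largest number of slices, a smallest slice is
so thin that removing it decreases `cascade` by at most the value of `cascade (d - 1)` at the slice,
which the projections of the slice account for by induction. This rests on an exchange inequality
for `cascade`, proved together with its subadditivity.

It remains to compare the box of the theorem with `cascade`. Half the surface area of a box is the
derivative, with respect to the simultaneous growth of all sides, of its volume. If the volume is
`ℓ ^ d - q(ℓ)` for a polynomial `q` of degree less than `d`, then splitting off a balanced box
leaves a facet of volume `ℓ ^ (d - 1) - g(ℓ)`, and the coefficients of `g` are at most quadratic in
those of `q`. The splitting needs a leading coefficient less than `ℓ` at every stage; starting from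
`p`, the `d - 1` stages cost at most `d - 1` squarings, hence the condition `p ^ 2 ^ (d - 1) ≤ ℓ`.
-/

open Finset Polynomial

section BalancedBoxes

/-- The side sum of the largest facet of the balanced box with `d + 1` sides summing to `N`:
that facet drops a shortest side, which is `N / (d + 1)`. -/
def facetSum (d N : ℕ) : ℕ := N - N / (d + 1)

/-- `∏ (X + a)` over the sides `a` of the balanced box in dimension `d`, the one whose sides sum
to `N` and differ by at most `1`. Its two lowest coefficients are the volume of the box and half of
its surface area. -/
noncomputable def balPoly : ℕ → ℕ → ℕ[X]
  | 0, _ => 1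
  | d + 1, N => (X + C (N / (d + 1))) * balPoly d (facetSum d N)

/-- The volume of the balanced box in dimension `d` with sides summing to `N`. -/
noncomputable def balVol (d N : ℕ) : ℕ := (balPoly d N).coeff 0

/-- Half the surface area of the balanced box in dimension `d` with sides summing to `N`. -/
noncomputable def balSurf (d N : ℕ) : ℕ := (balPoly d N).coeff 1

theorem succ_div_succ_eq_or (N d : ℕ) :
    (N + 1) / (d + 1) = N / (d + 1) ∨ (N + 1) / (d + 1) = N / (d + 1) + 1 := by
  rw [Nat.succ_div]
  split_ifs <;> simp

theorem facetSum_mono (d : ℕ) : Monotone (facetSum d) := by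
  refine monotone_nat_of_le_succ fun N => ?_
  rcases succ_div_succ_eq_or N d with h | h <;> simp only [facetSum, h] <;> omega

theorem facetSum_succ_le (d N : ℕ) : facetSum d (N + 1) ≤ facetSum d N + 1 := by
  have : N / (d + 1) ≤ (N + 1) / (d + 1) := Nat.div_le_div_right N.le_succ
  simp only [facetSum]
  omega

theorem facetSum_mul (d b : ℕ) : facetSum d ((d + 1) * b) = d * b := by
  rw [facetSum, Nat.mul_div_cancel_left _ d.succ_pos, Nat.succ_mul, Nat.add_sub_cancel]

theorem facetSum_of_succ_eq_mul {d N b : ℕ} (h : N + 1 = (d + 1) * b) : facetSum d N = d * b := by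
  obtain ⟨k, rfl⟩ : ∃ k, b = k + 1 := Nat.exists_eq_succ_of_ne_zero (by rintro rfl; omega)
  have hN : N = (d + 1) * k + d := by linarith
  rw [facetSum, hN, Nat.mul_add_div d.succ_pos, Nat.div_eq_of_lt d.lt_succ_self]
  have : (d + 1) * k = d * k + k := Nat.succ_mul d k
  have : d * (k + 1) = d * k + d := Nat.mul_succ d k
  omega

theorem facetSum_div_of_succ_div_eq {d N : ℕ} (h : (N + 1) / (d + 2) = N / (d + 2)) :
    facetSum (d + 1) N / (d + 1) = N / (d + 2) := by
  have hN := Nat.div_add_mod N (d + 2)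
  have hN' := Nat.div_add_mod (N + 1) (d + 2)
  have hmod := Nat.mod_lt (N + 1) (show 0 < d + 2 by omega)
  rw [h] at hN'
  simp only [facetSum, Nat.add_assoc, Nat.reduceAdd]
  generalize N / (d + 2) = k at *
  have : (d + 2) * k = k * (d + 1) + k := by ring
  have : (k + 1) * (d + 1) = k * (d + 1) + d + 1 := by ring
  apply Nat.div_eq_of_lt_le <;> omega

-- Increasing the side sum by one lengthens a shortest side.
theorem balPoly_succ_succ (d N : ℕ) :
    balPoly (d + 1) (N + 1) = (X + C (N / (d + 1) + 1)) * balPoly d (facetSum d N) := by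
  induction d generalizing N with
  | zero => simp [balPoly]
  | succ d ih =>
    rw [balPoly]
    rcases succ_div_succ_eq_or N (d + 1) with h | h
    · have hfacet : facetSum (d + 1) (N + 1) = facetSum (d + 1) N + 1 := by
        have := Nat.div_le_self N (d + 1 + 1)
        simp only [facetSum, h]
        omega
      rw [h, hfacet, ih, balPoly, facetSum_div_of_succ_div_eq h]
      ring
    · have hfacet : facetSum (d + 1) (N + 1) = facetSum (d + 1) N := by
        simp only [facetSum, h]
        omega
      rw [h, hfacet]

theorem balPoly_succ_succ_eq_add (d N : ℕ) :
    balPoly (d + 1) (N + 1) = balPoly (d + 1) N + balPoly d (facetSum d N) := by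
  rw [balPoly_succ_succ, balPoly, C_add, C_1]
  ring

theorem balPoly_mul (d b : ℕ) : balPoly d (d * b) = (X + C b) ^ d := by
  induction d with
  | zero => simp [balPoly]
  | succ d ih => rw [balPoly, facetSum_mul, ih, Nat.mul_div_cancel_left _ d.succ_pos, pow_succ']

@[simp] theorem balVol_zero_left (N : ℕ) : balVol 0 N = 1 := by simp [balVol, balPoly]

@[simp] theorem balVol_succ_zero (d : ℕ) : balVol (d + 1) 0 = 0 := by simp [balVol, balPoly]

theorem balVol_succ_succ (d N : ℕ) :
    balVol (d + 1) (N + 1) = (N / (d + 1) + 1) * balVol d (facetSum d N) := by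
  simp [balVol, balPoly_succ_succ, mul_coeff_zero]

theorem balVol_succ_succ_eq_add (d N : ℕ) :
    balVol (d + 1) (N + 1) = balVol (d + 1) N + balVol d (facetSum d N) := by
  simp [balVol, balPoly_succ_succ_eq_add]

theorem balSurf_succ_succ_eq_add (d N : ℕ) :
    balSurf (d + 1) (N + 1) = balSurf (d + 1) N + balSurf d (facetSum d N) := by
  simp [balSurf, balPoly_succ_succ_eq_add]

theorem balVol_mul (d b : ℕ) : balVol d (d * b) = b ^ d := by
  rw [balVol, balPoly_mul, coeff_X_add_C_pow]
  simp

theorem balSurf_mul (d b : ℕ) : balSurf d (d * b) = d * b ^ (d - 1) := by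
  rw [balSurf, balPoly_mul, coeff_X_add_C_pow, Nat.choose_one_right, mul_comm, Nat.cast_id]

theorem balVol_mono (d : ℕ) : Monotone (balVol d) := by
  cases d with
  | zero => simp [Monotone]
  | succ d => exact monotone_nat_of_le_succ fun N => by simp [balVol_succ_succ_eq_add]

theorem balVol_facetSum_mono (d : ℕ) : Monotone fun N => balVol d (facetSum d N) :=
  (balVol_mono d).comp (facetSum_mono d)

theorem balVol_facetSum_le_pow {d N b : ℕ} (h : N ≤ (d + 1) * b) :
    balVol d (facetSum d N) ≤ b ^ d := by
  simpa only [facetSum_mul, balVol_mul] using balVol_facetSum_mono d h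

theorem pow_le_balVol_add {d b N c : ℕ} (h : N + c = (d + 1) * b) :
    b ^ (d + 1) ≤ balVol (d + 1) N + c * b ^ d := by
  induction c generalizing N with
  | zero => rw [← balVol_mul, ← h, zero_mul, add_zero, add_zero]
  | succ c ih =>
    have hstep := balVol_succ_succ_eq_add d N
    have hfacet : balVol d (facetSum d N) ≤ b ^ d := balVol_facetSum_le_pow (by omega)
    have := ih (N := N + 1) (by omega)
    rw [Nat.succ_mul]
    omega

theorem balVol_facetSum_pos {d N : ℕ} (h : 0 < balVol (d + 1) (N + 1)) :
    0 < balVol d (facetSum d N) := by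
  rw [balVol_succ_succ] at h
  exact Nat.pos_of_mul_pos_left h

theorem le_of_balVol_lt {d M N : ℕ} (h : balVol d M < balVol d (N + 1)) : M ≤ N :=
  Nat.lt_succ_iff.1 ((balVol_mono d).reflect_lt h)

theorem exists_eq_balVol_add (d : ℕ) {n : ℕ} (hn : 0 < n) :
    ∃ N r, 0 < r ∧ r ≤ balVol d (facetSum d N) ∧ n = balVol (d + 1) N + r := by
  classical
  have hex : ∃ N, n ≤ balVol (d + 1) N :=
    ⟨(d + 1) * n, by rw [balVol_mul]; exact Nat.le_self_pow d.succ_ne_zero n⟩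
  obtain ⟨N, hN⟩ : ∃ N, Nat.find hex = N + 1 := by
    refine Nat.exists_eq_succ_of_ne_zero fun h => ?_
    have := Nat.find_spec hex
    rw [h, balVol_succ_zero] at this
    omega
  have hle : n ≤ balVol (d + 1) (N + 1) := hN ▸ Nat.find_spec hex
  have hlt : balVol (d + 1) N < n := not_le.1 (Nat.find_min hex (by omega))
  have hstep := balVol_succ_succ_eq_add d N
  exact ⟨N, n - balVol (d + 1) N, by omega, by omega, by omega⟩

end BalancedBoxes

section Cascade

/-- The largest `N` with `balVol (d + 1) N < n`, for `0 < n`. -/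
noncomputable def balIdx (d n : ℕ) : ℕ :=
  sInf {N | n ≤ balVol (d + 1) (N + 1)}

/-- Half the edge perimeter of the configuration of `n` points obtained by growing balanced boxes,
each new facet being filled in the same fashion one dimension lower. -/
noncomputable def cascade : ℕ → ℕ → ℕ
  | 0, _ => 0
  | d + 1, n => if n = 0 then 0 else
      balSurf (d + 1) (balIdx d n) + cascade d (n - balVol (d + 1) (balIdx d n))

@[simp] theorem cascade_zero_left (n : ℕ) : cascade 0 n = 0 := rfl

@[simp] theorem cascade_zero_right (d : ℕ) : cascade d 0 = 0 := by
  cases d <;> simp [cascade]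

theorem balIdx_balVol_add {d N r : ℕ} (hr : 0 < r) (hr' : r ≤ balVol d (facetSum d N)) :
    balIdx d (balVol (d + 1) N + r) = N := by
  have hmem : balVol (d + 1) N + r ≤ balVol (d + 1) (N + 1) := by
    rw [balVol_succ_succ_eq_add]
    omega
  refine le_antisymm (Nat.sInf_le hmem) (le_csInf ⟨N, hmem⟩ fun M hM => ?_)
  exact le_of_balVol_lt ((Nat.lt_add_of_pos_right hr).trans_le hM)

theorem cascade_balVol_add_of_pos {d N r : ℕ} (hr : 0 < r) (hr' : r ≤ balVol d (facetSum d N)) :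
    cascade (d + 1) (balVol (d + 1) N + r) = balSurf (d + 1) N + cascade d r := by
  rw [cascade, if_neg (by omega), balIdx_balVol_add hr hr', Nat.add_sub_cancel_left]

theorem cascade_balVol {d N : ℕ} (h : 0 < balVol d N) : cascade d (balVol d N) = balSurf d N := by
  induction d generalizing N with
  | zero => simp [balSurf, balPoly, coeff_one]
  | succ d ih =>
    obtain ⟨N, rfl⟩ : ∃ K, N = K + 1 :=
      Nat.exists_eq_succ_of_ne_zero (by rintro rfl; simp at h)
    have hfacet := balVol_facetSum_pos h
    rw [balVol_succ_succ_eq_add, cascade_balVol_add_of_pos hfacet le_rfl, ih hfacet,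
      balSurf_succ_succ_eq_add]

-- Fails at `0`: the empty box with a single side `0` has positive surface area.
theorem cascade_balVol_add {d N r : ℕ} (h : 0 < balVol (d + 1) N + r)
    (hr : r ≤ balVol d (facetSum d N)) :
    cascade (d + 1) (balVol (d + 1) N + r) = balSurf (d + 1) N + cascade d r := by
  rcases r.eq_zero_or_pos with rfl | hpos
  · rw [add_zero] at h ⊢
    rw [cascade_balVol h, cascade_zero_right, add_zero]
  · exact cascade_balVol_add_of_pos hpos hr

theorem cascade_balVol_add_le {d N r : ℕ} (hr : r ≤ balVol d (facetSum d N)) :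
    cascade (d + 1) (balVol (d + 1) N + r) ≤ balSurf (d + 1) N + cascade d r := by
  rcases (balVol (d + 1) N + r).eq_zero_or_pos with h | h
  · simp [h]
  · exact (cascade_balVol_add h hr).le

theorem cascade_balVol_le (d N : ℕ) :
    cascade (d + 1) (balVol (d + 1) N) ≤ balSurf (d + 1) N := by
  simpa using cascade_balVol_add_le (d := d) (N := N) (Nat.zero_le _)

theorem cascade_pow {d b : ℕ} (hb : 0 < b) : cascade d (b ^ d) = d * b ^ (d - 1) := by
  rw [← balVol_mul, cascade_balVol (by rw [balVol_mul]; positivity), balSurf_mul]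

theorem cascade_one_right (d : ℕ) : cascade d 1 = d := by
  simpa using cascade_pow (d := d) one_pos

end Cascade

section Exchange

/-- Among all intervals of length `u` below the volume of a balanced box, the topmost one has the
least increment of the cascade function. -/
def CascadeExchange (d : ℕ) : Prop :=
  ∀ N a u y, a + u = balVol d N → y ≤ a →
    cascade d (a + u) + cascade d y ≤ cascade d a + cascade d (y + u)

/-- Subadditivity of the cascade function. -/
def CascadeSubadditive (d : ℕ) : Prop :=
  ∀ x y, cascade d (x + y) ≤ cascade d x + cascade d y

variable {d : ℕ}

theorem CascadeExchange.facet_increment_le (hE : CascadeExchange d) (hS : CascadeSubadditive d)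
    {N a u y : ℕ} (hau : a + u = balVol d (facetSum d N))
    (hyu : y + u ≤ balVol (d + 1) (N + 1)) :
    cascade d (a + u) + cascade (d + 1) y ≤ cascade d a + cascade (d + 1) (y + u) := by
  induction u using Nat.strong_induction_on generalizing a with
  | _ u ih =>
  rcases u.eq_zero_or_pos with rfl | hu
  · simp
  obtain ⟨M, w, hw, hw', hM⟩ := exists_eq_balVol_add d (n := y + u) (by omega)
  have hfacet : balVol d (facetSum d M) ≤ balVol d (facetSum d N) :=
    balVol_facetSum_mono d (le_of_balVol_lt (d := d + 1) (by omega))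
  have htop : cascade (d + 1) (y + u) = balSurf (d + 1) M + cascade d w := by
    rw [hM, cascade_balVol_add_of_pos hw hw']
  rcases le_or_gt u w with huw | huw
  · obtain ⟨v, rfl⟩ := Nat.exists_eq_add_of_le' huw
    have hbot := cascade_balVol_add_le (d := d) (N := M) (r := v) (by omega)
    rw [show balVol (d + 1) M + v = y by omega] at hbot
    have := hE _ a u v hau (by omega)
    omega
  · obtain ⟨u', rfl⟩ := Nat.exists_eq_add_of_le huw.le
    have hbox : y + u' = balVol (d + 1) M := by omega
    have hrest := ih u' (by omega) (a := a + w) (by omega) (by omega)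
    rw [hbox, add_assoc] at hrest
    have := hS a w
    have := cascade_balVol_le d M
    omega

theorem CascadeExchange.succ (hE : CascadeExchange d) (hS : CascadeSubadditive d) :
    CascadeExchange (d + 1) := by
  intro N
  induction N with
  | zero =>
    intro a u y hau hya
    rw [balVol_succ_zero] at hau
    obtain ⟨rfl, rfl, rfl⟩ : a = 0 ∧ u = 0 ∧ y = 0 := by omega
    rfl
  | succ N ih =>
    intro a u y hau hya
    rcases a.eq_zero_or_pos with rfl | ha
    · obtain rfl : y = 0 := by omega
      rw [add_comm]
    have hstep := balVol_succ_succ_eq_add d N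
    have htop := cascade_balVol_add_le (d := d) (N := N) le_rfl
    rw [← hstep, ← hau] at htop
    rcases le_or_gt u (balVol d (facetSum d N)) with hu | hu
    · obtain ⟨b, hb⟩ := Nat.exists_eq_add_of_le' hu
      obtain rfl : a = balVol (d + 1) N + b := by omega
      have hbot := cascade_balVol_add (d := d) (N := N) (r := b) ha (by omega)
      have := hE.facet_increment_le hS hb.symm (y := y) (by omega)
      rw [hb] at htop
      omega
    · obtain ⟨v, rfl⟩ := Nat.exists_eq_add_of_le' hu.le
      have hbox : a + v = balVol (d + 1) N := by omega
      have hrest := ih a v y hbox hya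
      rw [hbox, cascade_balVol (by omega)] at hrest
      have := hE.facet_increment_le hS (zero_add (balVol d (facetSum d N))) (y := y + v) (by omega)
      rw [zero_add, cascade_zero_right, add_assoc y] at this
      omega

theorem CascadeExchange.cascade_add_le (hE : CascadeExchange d) (hS : CascadeSubadditive d)
    {N x w : ℕ} (hx : 0 < x) (hNx : balVol (d + 1) N ≤ x) (hw : w ≤ balVol d (facetSum d N)) :
    cascade (d + 1) (x + w) ≤ cascade (d + 1) x + cascade d w := by
  obtain ⟨M, b, hb, hb', hM⟩ := exists_eq_balVol_add d x.succ_pos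
  obtain ⟨b, rfl⟩ : ∃ b', b = b' + 1 := Nat.exists_eq_succ_of_ne_zero hb.ne'
  obtain rfl : x = balVol (d + 1) M + b := by omega
  have hstep := balVol_succ_succ_eq_add d M
  have hw' : w ≤ balVol d (facetSum d M) :=
    hw.trans (balVol_facetSum_mono d (le_of_balVol_lt (d := d + 1) (by omega)))
  have hbot := cascade_balVol_add hx (d := d) (N := M) (r := b) (by omega)
  rcases le_or_gt (b + w) (balVol d (facetSum d M)) with hfit | hover
  · have htop := cascade_balVol_add (d := d) (N := M) (r := b + w) (by omega) hfit
    have := hS b w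
    rw [add_assoc]
    omega
  · obtain ⟨t, ht⟩ := Nat.exists_eq_add_of_le (show b ≤ balVol d (facetSum d M) by omega)
    obtain ⟨s, rfl⟩ := Nat.exists_eq_add_of_le' (show t ≤ w by omega)
    have hfacet : balVol d (facetSum d M) ≤ balVol d (facetSum d (M + 1)) :=
      balVol_facetSum_mono d M.le_succ
    have htop := cascade_balVol_add (d := d) (N := M + 1) (r := s) (by omega) (by omega)
    rw [balSurf_succ_succ_eq_add, ← cascade_balVol (N := facetSum d M) (by omega), ht] at htop
    have := hE _ b t s ht.symm (by omega)
    rw [show balVol (d + 1) M + b + (s + t) = balVol (d + 1) (M + 1) + s by omega]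
    omega

theorem CascadeExchange.subadditive_succ (hE : CascadeExchange d) (hS : CascadeSubadditive d) :
    CascadeSubadditive (d + 1) := by
  suffices h : ∀ y x, y ≤ x → cascade (d + 1) (x + y) ≤ cascade (d + 1) x + cascade (d + 1) y by
    intro x y
    rcases le_total y x with hyx | hxy
    · exact h y x hyx
    · rw [add_comm x, add_comm (cascade _ x)]
      exact h x y hxy
  intro y
  induction y using Nat.strong_induction_on with
  | _ y ih =>
  intro x hyx
  rcases y.eq_zero_or_pos with rfl | hy
  · simp
  obtain ⟨M, w, hw, hw', rfl⟩ := exists_eq_balVol_add d hy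
  have hbox := ih (balVol (d + 1) M) (by omega) (x + w) (by omega)
  have hpart := hE.cascade_add_le hS (x := x) (by omega) (by omega) hw'
  have := cascade_balVol_le d M
  rw [cascade_balVol_add_of_pos hw hw', ← add_assoc, add_right_comm]
  omega

theorem cascadeExchange_and_cascadeSubadditive (d : ℕ) :
    CascadeExchange d ∧ CascadeSubadditive d := by
  induction d with
  | zero => simp [CascadeExchange, CascadeSubadditive]
  | succ d ih => exact ⟨ih.1.succ ih.2, ih.1.subadditive_succ ih.2⟩

theorem cascade_facet_increment_le {N a u y : ℕ} (hau : a + u = balVol d (facetSum d N))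
    (hyu : y + u ≤ balVol (d + 1) (N + 1)) :
    cascade d (a + u) + cascade (d + 1) y ≤ cascade d a + cascade (d + 1) (y + u) :=
  have ⟨hE, hS⟩ := cascadeExchange_and_cascadeSubadditive d
  hE.facet_increment_le hS hau hyu

theorem cascade_add_le_of_le_facet {N x w : ℕ} (hx : 0 < x) (hNx : balVol (d + 1) N ≤ x)
    (hw : w ≤ balVol d (facetSum d N)) :
    cascade (d + 1) (x + w) ≤ cascade (d + 1) x + cascade d w :=
  have ⟨hE, hS⟩ := cascadeExchange_and_cascadeSubadditive d
  hE.cascade_add_le hS hx hNx hw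

end Exchange

section Slices

theorem lt_mul_of_balVol_lt_pow {d N b : ℕ} (h : balVol (d + 1) N < b ^ (d + 1)) :
    N < (d + 1) * b := by
  rw [← balVol_mul] at h
  exact (balVol_mono _).reflect_lt h

theorem balVol_succ_le_mul_facet {d N b : ℕ} (h : N < (d + 1) * b) :
    balVol (d + 1) (N + 1) ≤ b * balVol d (facetSum d N) := by
  rw [balVol_succ_succ]
  exact Nat.mul_le_mul_right _ (Nat.div_lt_of_lt_mul h)

theorem le_facet_of_mul_le {d N b m r : ℕ} (h : N < (d + 1) * b)
    (hr : r ≤ balVol d (facetSum d N)) (hm : m * b ≤ balVol (d + 1) N + r) :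
    m ≤ balVol d (facetSum d N) := by
  have hb : 0 < b := Nat.pos_of_mul_pos_left (h.trans_le' N.zero_le)
  have := balVol_succ_le_mul_facet h
  rw [balVol_succ_succ_eq_add] at this
  exact Nat.le_of_mul_le_mul_right (by linarith) hb

theorem excess_mul_le {d N b m r : ℕ} (h : N < (d + 1) * b)
    (hm : (balVol d (facetSum d N) + m) * b ≤ balVol (d + 1) (N + 1) + r) : m * b ≤ r := by
  have := balVol_succ_le_mul_facet h
  linarith

-- The slice may be larger than the facet below `x`; its excess over that facet is then again a
-- slice of at most average size, one dimension lower.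
theorem cascade_add_le_of_mul_le {d b x m : ℕ} (hx : 0 < x) (hm : m * b ≤ x + m)
    (hb : x + m ≤ b ^ (d + 1)) :
    cascade (d + 1) (x + m) ≤ cascade (d + 1) x + cascade d m := by
  induction d generalizing x m with
  | zero =>
    obtain ⟨N, r, hr, hr', hN⟩ := exists_eq_balVol_add 0 (n := x + m) (by omega)
    have hmN := le_facet_of_mul_le (lt_mul_of_balVol_lt_pow (by omega)) hr' (hN ▸ hm)
    rw [balVol_zero_left] at hmN
    exact cascade_add_le_of_le_facet (N := N) hx (by omega) (by simpa using hmN)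
  | succ d ih =>
    obtain ⟨N, r, hr, hr', hN⟩ := exists_eq_balVol_add (d + 1) (n := x + m) (by omega)
    have hNb : N < (d + 1 + 1) * b := lt_mul_of_balVol_lt_pow (by omega)
    have hmN := le_facet_of_mul_le hNb hr' (hN ▸ hm)
    rcases le_or_gt m r with hmr | hmr
    · exact cascade_add_le_of_le_facet hx (by omega) hmN
    obtain ⟨L, rfl⟩ : ∃ L, N = L + 1 :=
      Nat.exists_eq_succ_of_ne_zero (by rintro rfl; rw [balVol_succ_zero] at hN; omega)
    have hL := balVol_succ_succ_eq_add (d + 1) L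
    rcases le_or_gt m (balVol (d + 1) (facetSum (d + 1) L)) with hmL | hmL
    · exact cascade_add_le_of_le_facet hx (by omega) hmL
    obtain ⟨m', rfl⟩ := Nat.exists_eq_add_of_le hmL.le
    have hexcess : m' * b ≤ r := excess_mul_le (by omega) (hN ▸ hm)
    have hb2 : 2 ≤ b := by
      by_contra! hb1
      have := Nat.pow_le_one_iff (n := d + 1 + 1) (by omega) |>.2 (Nat.lt_succ_iff.1 hb1)
      omega
    obtain ⟨x', rfl⟩ := Nat.exists_eq_add_of_le' (show m' ≤ r by nlinarith)
    obtain rfl : x = balVol (d + 1 + 1) L + x' := by omega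
    have hm' : m' ≤ balVol d (facetSum d (facetSum (d + 1) L)) := by
      have := hmN.trans (balVol_mono _ (facetSum_succ_le (d + 1) L))
      rw [balVol_succ_succ_eq_add] at this
      omega
    have := ih (by nlinarith) hexcess (hr'.trans (balVol_facetSum_le_pow hNb.le))
    rw [hN, cascade_balVol_add_of_pos hr hr', balSurf_succ_succ_eq_add,
      cascade_balVol_add hx (by omega), cascade_balVol_add_of_pos (by omega) hm']
    omega

end Slices

section Projections

variable {ι α : Type*} [DecidableEq α]

theorem exists_fiber_card_mul_le {β : Type*} (C : Finset β) (f : β → α) (hC : C.Nonempty) :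
    ∃ t ∈ C.image f, #{x ∈ C | f x = t} * #(C.image f) ≤ #C := by
  obtain ⟨t, ht, hmin⟩ :=
    exists_min_image (C.image f) (fun t => #{x ∈ C | f x = t}) (hC.image f)
  refine ⟨t, ht, ?_⟩
  rw [card_eq_sum_card_image f C, mul_comm, ← smul_eq_mul]
  exact card_nsmul_le_sum _ _ _ hmin

theorem card_le_prod_card_image {I : Finset ι} {C : Finset (ι → α)}
    (hI : Set.InjOn I.restrict (C : Set (ι → α))) :
    #C ≤ ∏ i ∈ I, #(C.image fun x => x i) := by
  classical
  rw [← prod_coe_sort, ← Fintype.card_piFinset]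
  refine card_le_card_of_injOn _ (fun x hx => ?_) hI
  exact Fintype.mem_piFinset.2 fun i => mem_image_of_mem _ hx

theorem exists_thin_slice {I : Finset ι} {C : Finset (ι → α)}
    (hI : Set.InjOn I.restrict (C : Set (ι → α))) (hC : 1 < #C) :
    ∃ i ∈ I, ∃ t b, {x ∈ C | x i = t}.Nonempty ∧ {x ∈ C | x i ≠ t}.Nonempty ∧
      #{x ∈ C | x i = t} * b ≤ #C ∧ #C ≤ b ^ #I := by
  have hprod := card_le_prod_card_image hI
  have hI0 : I.Nonempty := by
    by_contra! h
    rw [h, prod_empty] at hprod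
    omega
  obtain ⟨i, hi, hmax⟩ := exists_max_image I (fun i => #(C.image fun x => x i)) hI0
  have hpow := hprod.trans (prod_le_pow_card _ _ _ hmax)
  obtain ⟨t, ht, hthin⟩ :=
    exists_fiber_card_mul_le C (fun x => x i) (card_pos.1 (by omega))
  obtain ⟨u, hu, hut⟩ : ∃ u ∈ C.image fun x => x i, u ≠ t := by
    refine exists_mem_ne (not_le.1 fun h => ?_) t
    have : #(C.image fun x => x i) ^ #I ≤ 1 := pow_le_one' h _
    omega
  obtain ⟨x, hx, rfl⟩ := mem_image.1 ht
  obtain ⟨y, hy, rfl⟩ := mem_image.1 hu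
  exact ⟨i, hi, x i, _, ⟨x, by simp [hx]⟩, ⟨y, by simp [hy, hut]⟩, hthin, hpow⟩

variable [DecidableEq ι]

theorem injOn_restrict_erase_slice {I : Finset ι} {C : Finset (ι → α)}
    (hI : Set.InjOn I.restrict (C : Set (ι → α))) (i : ι) (t : α) :
    Set.InjOn (I.erase i).restrict (({x ∈ C | x i = t} : Finset (ι → α)) : Set (ι → α)) := by
  intro x hx y hy hxy
  rw [mem_coe, mem_filter] at hx hy
  refine hI hx.1 hy.1 (funext fun ⟨j, hj⟩ => ?_)
  by_cases hji : j = i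
  · simp [hji, hx.2, hy.2]
  · exact congrFun hxy ⟨j, mem_erase.2 ⟨hji, hj⟩⟩

variable [Fintype ι]

/-- The projection of `C` along the coordinate direction `i`; its points are the lines in that
direction meeting `C`. -/
def projection (C : Finset (ι → α)) (i : ι) : Finset ({j // j ≠ i} → α) :=
  C.image fun x j => x j

theorem projection_mono {C D : Finset (ι → α)} (h : C ⊆ D) (i : ι) :
    projection C i ⊆ projection D i :=
  image_subset_image h

theorem card_projection_ne_add_card_projection_eq (C : Finset (ι → α)) {i j : ι} (hij : i ≠ j)
    (t : α) :
    #(projection {x ∈ C | x i ≠ t} j) + #(projection {x ∈ C | x i = t} j) =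
      #(projection C j) := by
  rw [← card_filter_add_card_filter_not (s := projection C j) fun z => z ⟨i, hij⟩ = t, add_comm]
  simp only [projection, filter_image, ne_eq]

theorem sum_card_projection_slices_le (C : Finset (ι → α)) {I : Finset ι} {i : ι} (hi : i ∈ I)
    (t : α) :
    ∑ j ∈ I, #(projection {x ∈ C | x i ≠ t} j) +
      ∑ j ∈ I.erase i, #(projection {x ∈ C | x i = t} j) ≤ ∑ j ∈ I, #(projection C j) := by
  rw [← add_sum_erase _ _ hi, ← add_sum_erase I (fun j => #(projection C j)) hi, add_assoc,
    ← sum_add_distrib]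
  refine add_le_add (card_le_card (projection_mono (filter_subset _ _) i)) (sum_le_sum ?_)
  exact fun j hj => (card_projection_ne_add_card_projection_eq C (ne_of_mem_erase hj).symm t).le

theorem cascade_card_le_sum_card_projection {I : Finset ι} {C : Finset (ι → α)}
    (hI : Set.InjOn I.restrict (C : Set (ι → α))) :
    cascade #I #C ≤ ∑ i ∈ I, #(projection C i) := by
  induction C using Finset.strongInduction generalizing I with
  | H C ih =>
  rcases lt_trichotomy #C 1 with h0 | h1 | h2
  · simp [Nat.lt_one_iff.1 h0]
  · rw [h1, cascade_one_right, card_eq_sum_ones]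
    have hne : C.Nonempty := card_pos.1 (by omega)
    exact sum_le_sum fun i _ => card_pos.2 (hne.image _)
  · obtain ⟨i, hi, t, b, ⟨x, hx⟩, ⟨y, hy⟩, hthin, hpow⟩ := exists_thin_slice hI h2
    have hslice := ih {x ∈ C | x i = t}
      (filter_ssubset.2 ⟨y, by simp_all⟩) (injOn_restrict_erase_slice hI i t)
    have hrest := ih {x ∈ C | x i ≠ t} (filter_ssubset.2 ⟨x, by simp_all⟩)
      (hI.mono (filter_subset _ C))
    have hcard : #{x ∈ C | x i ≠ t} + #{x ∈ C | x i = t} = #C := by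
      rw [add_comm, card_filter_add_card_filter_not]
    obtain ⟨d, hd⟩ : ∃ d, #I = d + 1 := Nat.exists_eq_succ_of_ne_zero (card_ne_zero_of_mem hi)
    rw [card_erase_of_mem hi, hd, Nat.add_sub_cancel] at hslice
    rw [hd] at hrest hpow ⊢
    rw [← hcard] at hthin hpow ⊢
    calc _ ≤ _ := cascade_add_le_of_mul_le (card_pos.2 ⟨y, hy⟩) hthin hpow
      _ ≤ _ := add_le_add hrest hslice
      _ ≤ _ := sum_card_projection_slices_le C hi t

end Projections

section EdgePerimeter

/-- The points of `C` whose translate by `s` in the direction `i` leaves `C`. -/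
def exitPoints {ι : Type*} [Fintype ι] [DecidableEq ι] (C : Finset (ι → ℤ)) (i : ι) (s : ℤ) :
    Finset (ι → ℤ) :=
  {x ∈ C | x + Pi.single i s ∉ C}

section

variable {ι : Type*} [Fintype ι] [DecidableEq ι]

theorem card_projection_le_card_exitPoints (C : Finset (ι → ℤ)) (i : ι) {s : ℤ} (hs : s ≠ 0) :
    #(projection C i) ≤ #(exitPoints C i s) := by
  refine (card_le_card fun z hz => ?_).trans
    (card_image_le (s := exitPoints C i s) (f := fun x (j : {j // j ≠ i}) => x j))
  have hline : {x ∈ C | (fun j : {j // j ≠ i} => x j) = z}.Nonempty := by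
    obtain ⟨x, hx, rfl⟩ := mem_image.1 hz
    exact ⟨x, by simp [hx]⟩
  obtain ⟨y, hy, hmax⟩ := exists_max_image _ (fun y => s * y i) hline
  obtain ⟨hyC, hyz⟩ := mem_filter.1 hy
  refine mem_image.2 ⟨y, mem_filter.2 ⟨hyC, fun hexit => ?_⟩, hyz⟩
  have hle := hmax _ (mem_filter.2 ⟨hexit, by rw [← hyz]; ext j; simp [j.2]⟩)
  simp only [Pi.add_apply, Pi.single_eq_same, mul_add] at hle
  exact (mul_self_pos.2 hs).not_ge (by linarith)

theorem sum_sq_eq_one_iff {v : ι → ℤ} :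
    ∑ i, v i ^ 2 = 1 ↔ ∃ (i : ι) (s : ℤˣ), v = Pi.single i (s : ℤ) := by
  constructor
  · intro h
    obtain ⟨i, -, hi⟩ : ∃ i ∈ univ, v i ^ 2 ≠ 0 := exists_ne_zero_of_sum_ne_zero (by omega)
    have hpos : 0 < v i ^ 2 := lt_of_le_of_ne (sq_nonneg _) hi.symm
    rw [← add_sum_erase _ _ (mem_univ i)] at h
    have hnonneg : ∀ j ∈ univ.erase i, 0 ≤ v j ^ 2 := fun j _ => sq_nonneg _
    have hrest : ∑ j ∈ univ.erase i, v j ^ 2 = 0 := by linarith [sum_nonneg hnonneg]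
    obtain ⟨s, hs⟩ : IsUnit (v i) := IsUnit.of_mul_eq_one (v i) (by linarith [sq (v i)])
    refine ⟨i, s, funext fun j => ?_⟩
    rcases eq_or_ne j i with rfl | hj
    · simp [hs]
    · rw [Pi.single_eq_of_ne hj]
      exact pow_eq_zero_iff two_ne_zero |>.1 <|
        (sum_eq_zero_iff_of_nonneg hnonneg).1 hrest j (mem_erase.2 ⟨hj, mem_univ j⟩)
  · rintro ⟨i, s, rfl⟩
    rw [sum_eq_single i (fun j _ hj => by simp [hj]) (by simp), Pi.single_eq_same,
      ← Units.val_pow_eq_pow_val, Int.units_sq, Units.val_one]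

end

variable {d : ℕ}

theorem edgePerimeter_eq_sum (C : Finset (Fin d → ℤ)) :
    edgePerimeter C = ∑ i, ∑ s : ℤˣ, #(exitPoints C i s) := by
  have himage : edgeBoundary (C : Set (Fin d → ℤ)) =
      ((univ : Finset (Fin d × ℤˣ)).sigma fun q => exitPoints C q.1 q.2).image
        fun q => (q.2, q.2 + Pi.single q.1.1 (q.1.2 : ℤ)) := by
    ext ⟨x, y⟩
    have hneg : ∑ i, (x i - y i) ^ 2 = ∑ i, (y - x) i ^ 2 :=
      sum_congr rfl fun i _ => sub_sq_comm _ _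
    rw [edgeBoundary, Set.mem_ofPred_eq, hneg, sum_sq_eq_one_iff]
    simp only [exitPoints, coe_image, coe_sigma, Set.mem_image, Set.mem_sigma_iff, mem_coe,
      mem_univ, true_and, mem_filter, Prod.mk.injEq, sub_eq_iff_eq_add']
    constructor
    · rintro ⟨⟨i, s, rfl⟩, hx, hy⟩
      exact ⟨⟨(i, s), x⟩, ⟨hx, hy⟩, rfl, rfl⟩
    · rintro ⟨⟨⟨i, s⟩, z⟩, ⟨hz, hz'⟩, rfl, rfl⟩
      exact ⟨⟨i, s, rfl⟩, hz, hz'⟩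
  rw [edgePerimeter, himage, Set.ncard_coe_finset, card_image_of_injOn, card_sigma,
    Fintype.sum_prod_type]
  rintro ⟨⟨i, s⟩, x⟩ - ⟨⟨j, t⟩, y⟩ - h
  simp only [Prod.mk.injEq] at h
  obtain ⟨rfl, h⟩ := h
  replace h := add_left_cancel h
  obtain rfl : i = j := by
    by_contra hij
    exact s.ne_zero (by simpa [Pi.single_eq_of_ne hij] using congrFun h i)
  rw [Units.val_inj.1 (Pi.single_injective i h)]

theorem two_mul_cascade_le_edgePerimeter (C : Finset (Fin d → ℤ)) :
    2 * cascade d #C ≤ edgePerimeter C := by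
  have hproj : cascade d #C ≤ ∑ i, #(projection C i) := by
    simpa using cascade_card_le_sum_card_projection (I := univ) (C := C)
      fun x _ y _ hxy => funext fun i => congrFun hxy ⟨i, mem_univ i⟩
  calc 2 * cascade d #C ≤ ∑ i, ∑ _s : ℤˣ, #(projection C i) := by
        simpa [← mul_sum] using hproj
    _ ≤ ∑ i, ∑ s : ℤˣ, #(exitPoints C i s) := by
        gcongr with i _ s
        exact card_projection_le_card_exitPoints C i s.ne_zero
    _ = edgePerimeter C := (edgePerimeter_eq_sum C).symm

theorem isEIPMinimizer_of_le_cascade {C : Finset (Fin d → ℤ)}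
    (h : edgePerimeter C ≤ 2 * cascade d #C) : IsEIPMinimizer C := by
  refine Or.inr (le_antisymm (le_csInf ⟨_, C, rfl, rfl⟩ ?_) (Nat.sInf_le ⟨C, rfl, rfl⟩))
  rintro m ⟨D, hD, rfl⟩
  rw [← hD] at h
  exact h.trans (two_mul_cascade_le_edgePerimeter D)

theorem card_exitPoints_piFinset_Icc_le {ι : Type*} [Fintype ι] [DecidableEq ι] (a b : ι → ℤ)
    (i : ι) (s : ℤˣ) :
    #(exitPoints (Fintype.piFinset fun j => Icc (a j) (b j)) i s) ≤
      ∏ j ∈ univ.erase i, #(Icc (a j) (b j)) := by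
  have hsub : exitPoints (Fintype.piFinset fun j => Icc (a j) (b j)) i s ⊆
      Fintype.piFinset
        (Function.update (fun j => Icc (a j) (b j)) i {if s = 1 then b i else a i}) := by
    intro x hx
    rw [exitPoints, mem_filter, Fintype.mem_piFinset] at hx
    obtain ⟨hx, hexit⟩ := hx
    refine Fintype.mem_piFinset.2 fun j => ?_
    rcases eq_or_ne j i with rfl | hj
    · have hxj := mem_Icc.1 (hx j)
      have hout : x j + s ∉ Icc (a j) (b j) := fun h => hexit <| Fintype.mem_piFinset.2 fun k => by
        rcases eq_or_ne k j with rfl | hk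
        · simpa using h
        · simpa [hk] using hx k
      rw [Function.update_self, mem_singleton]
      rw [mem_Icc] at hout
      rcases Int.units_eq_one_or s with rfl | rfl
      · rw [if_pos rfl]
        rw [Units.val_one] at hout
        omega
      · rw [if_neg (by decide)]
        rw [Units.val_neg, Units.val_one] at hout
        omega
    · rw [Function.update_of_ne hj]
      exact hx j
  refine (card_le_card hsub).trans_eq ?_
  rw [Fintype.card_piFinset, ← mul_prod_erase _ _ (mem_univ i), Function.update_self,
    card_singleton, one_mul]
  exact prod_congr rfl fun j hj => by rw [Function.update_of_ne (ne_of_mem_erase hj)]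

theorem edgePerimeter_piFinset_Icc_le (a b : Fin d → ℤ) :
    edgePerimeter (Fintype.piFinset fun j => Icc (a j) (b j)) ≤
      2 * (∏ j, (X + C #(Icc (a j) (b j)))).coeff 1 := by
  have hcoeff : (∏ j, (X + C #(Icc (a j) (b j)))).coeff 1 =
      ∑ i, ∏ j ∈ univ.erase i, #(Icc (a j) (b j)) := by
    have := coeff_derivative (∏ j, (X + C #(Icc (a j) (b j)))) 0
    rw [Nat.cast_zero, zero_add, mul_one] at this
    rw [← this, derivative_prod_finset, coeff_zero_eq_eval_zero, eval_finsetSum]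
    simp [eval_prod]
  rw [edgePerimeter_eq_sum, hcoeff, mul_sum]
  gcongr with i
  calc ∑ s : ℤˣ, #(exitPoints (Fintype.piFinset fun j => Icc (a j) (b j)) i s)
      ≤ ∑ _s : ℤˣ, ∏ j ∈ univ.erase i, #(Icc (a j) (b j)) :=
        sum_le_sum fun s _ => card_exitPoints_piFinset_Icc_le a b i s
    _ = 2 * ∏ j ∈ univ.erase i, #(Icc (a j) (b j)) := by simp

end EdgePerimeter

section BinomialCoefficients

theorem choose_add_mul_choose_le (s z m : ℕ) :
    s.choose (m + 1) + z * s.choose m ≤ (s + z).choose (m + 1) := by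
  induction z with
  | zero => simp
  | succ z ih =>
    have hmono : s.choose m ≤ (s + z).choose m := Nat.choose_le_choose m (Nat.le_add_right s z)
    rw [← add_assoc, Nat.choose_succ_succ', Nat.succ_mul]
    omega

theorem choose_add_choose_le (x y m : ℕ) :
    x.choose (m + 1) + y.choose (m + 1) ≤ (x + y).choose (m + 1) := by
  induction y with
  | zero => simp
  | succ y ih =>
    have hmono : y.choose m ≤ (x + y).choose m := Nat.choose_le_choose m (Nat.le_add_left y x)
    rw [← add_assoc, Nat.choose_succ_succ', Nat.choose_succ_succ']
    omega

theorem choose_le_choose_choose_two (a m : ℕ) :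
    a.choose (m + 2) ≤ (a.choose 2).choose (m + 1) := by
  induction a with
  | zero => simp
  | succ a ih =>
    rw [Nat.choose_succ_succ' a (m + 1), Nat.choose_succ_succ' a 1, Nat.choose_one_right]
    exact (Nat.add_le_add_left ih _).trans (choose_add_choose_le a (a.choose 2) m)

theorem choose_two_succ_add_choose_two (a : ℕ) : (a + 1).choose 2 + a.choose 2 = a ^ 2 := by
  induction a with
  | zero => rfl
  | succ a ih =>
    rw [Nat.choose_succ_succ' (a + 1), Nat.choose_one_right]
    have := Nat.choose_succ_succ' a 1
    rw [Nat.choose_one_right] at this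
    linarith

end BinomialCoefficients

section ShiftedBoxes

theorem exists_defect_eq_add {d N s ℓ : ℕ} (h : N + s = (d + 1) * ℓ) :
    ∃ z t, N / (d + 1) + z = ℓ ∧ facetSum d N + t = d * ℓ ∧ t + z = s := by
  have hN : N ≤ (d + 1) * ℓ := by omega
  obtain ⟨z, hz⟩ := Nat.exists_eq_add_of_le (Nat.div_le_of_le_mul hN)
  obtain ⟨t, ht⟩ := Nat.exists_eq_add_of_le (facetSum_mul d ℓ ▸ facetSum_mono d hN)
  have hdiv : N / (d + 1) ≤ N := Nat.div_le_self _ _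
  refine ⟨z, t, hz.symm, ht.symm, ?_⟩
  rw [facetSum] at ht
  rw [Nat.succ_mul] at h
  omega

/-- The volume of the balanced box in dimension `d` with side sum `N`, as a polynomial in the
side `ℓ` of a reference cube: at `ℓ` it evaluates to that volume, and its derivative there to half
of the surface area. -/
noncomputable def shiftedBalPoly (ℓ d N : ℕ) : ℤ[X] :=
  ((balPoly d N).map (Nat.castRingHom ℤ)).comp (X - C (ℓ : ℤ))

theorem eval_shiftedBalPoly (ℓ d N : ℕ) : (shiftedBalPoly ℓ d N).eval (ℓ : ℤ) = balVol d N := by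
  simp [shiftedBalPoly, eval_comp, balVol, ← coeff_zero_eq_eval_zero]

theorem eval_derivative_shiftedBalPoly (ℓ d N : ℕ) :
    (shiftedBalPoly ℓ d N).derivative.eval (ℓ : ℤ) = balSurf d N := by
  simp [shiftedBalPoly, derivative_comp, eval_comp, balSurf, ← coeff_zero_eq_eval_zero,
    coeff_derivative]

@[simp] theorem shiftedBalPoly_zero_left (ℓ N : ℕ) : shiftedBalPoly ℓ 0 N = 1 := by
  simp [shiftedBalPoly, balPoly]

theorem shiftedBalPoly_succ {ℓ d N z : ℕ} (hz : N / (d + 1) + z = ℓ) :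
    shiftedBalPoly ℓ (d + 1) N = (X - C (z : ℤ)) * shiftedBalPoly ℓ d (facetSum d N) := by
  have hfactor : X - C (ℓ : ℤ) + C ((N / (d + 1) : ℕ) : ℤ) = X - C (z : ℤ) := by
    rw [← hz, Nat.cast_add, C_add]
    ring
  simp only [shiftedBalPoly, balPoly, Polynomial.map_mul, Polynomial.map_add, map_X, map_C,
    mul_comp, add_comp, X_comp, C_comp, Nat.coe_castRingHom, hfactor]

theorem monic_balPoly (d N : ℕ) : (balPoly d N).Monic := by
  induction d generalizing N with
  | zero => exact monic_one
  | succ d ih => exact (monic_X_add_C _).mul (ih _)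

theorem natDegree_balPoly (d N : ℕ) : (balPoly d N).natDegree = d := by
  induction d generalizing N with
  | zero => exact natDegree_one
  | succ d ih =>
    rw [balPoly, (monic_X_add_C _).natDegree_mul (monic_balPoly d _), natDegree_X_add_C, ih,
      add_comm]

theorem monic_shiftedBalPoly (ℓ d N : ℕ) : (shiftedBalPoly ℓ d N).Monic :=
  ((monic_balPoly d N).map _).comp_X_sub_C _

theorem natDegree_shiftedBalPoly (ℓ d N : ℕ) : (shiftedBalPoly ℓ d N).natDegree = d := by
  rw [shiftedBalPoly, natDegree_comp, natDegree_X_sub_C, mul_one, (monic_balPoly d N).natDegree_map,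
    natDegree_balPoly]

theorem coeff_shiftedBalPoly_self (ℓ d N : ℕ) : (shiftedBalPoly ℓ d N).coeff d = 1 := by
  have h := (monic_shiftedBalPoly ℓ d N).coeff_natDegree
  rwa [natDegree_shiftedBalPoly] at h

theorem coeff_shiftedBalPoly_succ {ℓ d N s : ℕ} (h : N + s = (d + 1) * ℓ) :
    (shiftedBalPoly ℓ (d + 1) N).coeff d = -s := by
  induction d generalizing N s with
  | zero =>
    obtain ⟨z, t, hz, ht, rfl⟩ := exists_defect_eq_add h
    obtain rfl : t = 0 := by omega
    simp [shiftedBalPoly_succ hz]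
  | succ d ih =>
    obtain ⟨z, t, hz, ht, rfl⟩ := exists_defect_eq_add h
    rw [shiftedBalPoly_succ hz, sub_mul, coeff_sub, coeff_X_mul, coeff_C_mul, ih ht,
      coeff_shiftedBalPoly_self]
    push_cast
    ring

-- Up to sign the coefficients are the elementary symmetric functions of nonnegative integers with
-- sum `s`.
theorem abs_coeff_shiftedBalPoly_le {ℓ d N s j m : ℕ} (h : N + s = d * ℓ) (hj : j + m = d) :
    |(shiftedBalPoly ℓ d N).coeff j| ≤ s.choose m := by
  induction d generalizing N s j m with
  | zero =>
    obtain ⟨rfl, rfl⟩ : j = 0 ∧ m = 0 := by omega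
    simp
  | succ d ih =>
    rcases m with - | m
    · obtain rfl : j = d + 1 := by omega
      simp [coeff_shiftedBalPoly_self]
    obtain ⟨z, t, hz, ht, rfl⟩ := exists_defect_eq_add h
    have hchoose : (t.choose (m + 1) : ℤ) + z * t.choose m ≤ (t + z).choose (m + 1) :=
      mod_cast choose_add_mul_choose_le t z m
    have hconst : |(z : ℤ) * (shiftedBalPoly ℓ d (facetSum d N)).coeff j| ≤ z * t.choose m := by
      rw [abs_mul, Nat.abs_cast]
      gcongr
      exact ih ht (by omega)
    rw [shiftedBalPoly_succ hz, sub_mul, coeff_sub, coeff_C_mul]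
    rcases j with - | j
    · rw [mul_coeff_zero, coeff_X_zero, zero_mul, zero_sub, abs_neg]
      have : (0 : ℤ) ≤ t.choose (m + 1) := Int.natCast_nonneg _
      linarith
    · rw [coeff_X_mul]
      have hshift := ih ht (j := j) (m := m + 1) (by omega)
      exact (abs_sub _ _).trans (by linarith)

end ShiftedBoxes

section DerivativeBound

theorem cascade_add_pow_le {ℓ d j y : ℕ} (hℓ : 0 < ℓ) (hj : j < d) (hy : y + ℓ ^ j ≤ ℓ ^ d) :
    cascade d y + j * ℓ ^ (j - 1) ≤ cascade d (y + ℓ ^ j) := by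
  induction d generalizing y with
  | zero => omega
  | succ d ih =>
    obtain ⟨N, hN⟩ : ∃ N, N + 1 = (d + 1) * ℓ :=
      ⟨(d + 1) * ℓ - 1, Nat.sub_add_cancel (Nat.mul_pos d.succ_pos hℓ)⟩
    have hfacet : balVol d (facetSum d N) = ℓ ^ d := by
      rw [facetSum_of_succ_eq_mul hN, balVol_mul]
    have hle : ℓ ^ j ≤ ℓ ^ d := Nat.pow_le_pow_right hℓ (by omega)
    obtain ⟨a, ha⟩ := Nat.exists_eq_add_of_le' hle
    have hincr := cascade_facet_increment_le (y := y) (ha ▸ hfacet.symm)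
      (by rwa [hN, balVol_mul])
    rcases (Nat.lt_succ_iff.1 hj).lt_or_eq with hlt | rfl
    · have := ih hlt ha.ge
      omega
    · obtain rfl : a = 0 := by omega
      rw [zero_add, cascade_pow hℓ, cascade_zero_right] at hincr
      omega

theorem cascade_add_derivative_le {ℓ d y : ℕ} {a : ℕ[X]} (hℓ : 0 < ℓ) (ha : a.natDegree ≤ d)
    (hy : y + a.eval ℓ ≤ ℓ ^ (d + 1)) :
    cascade (d + 1) y + a.derivative.eval ℓ ≤ cascade (d + 1) (y + a.eval ℓ) := by
  refine induction_with_natDegree_le (fun a => ∀ y, y + a.eval ℓ ≤ ℓ ^ (d + 1) →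
    cascade (d + 1) y + a.derivative.eval ℓ ≤ cascade (d + 1) (y + a.eval ℓ)) d (by simp)
    ?monomial ?add a ha y hy
  case monomial =>
    intro j r hr hj y hy
    simp only [eval_mul, eval_C, eval_pow, eval_X, derivative_C_mul_X_pow, Nat.cast_id] at hy ⊢
    clear hr ha
    induction r with
    | zero => simp
    | succ r ih =>
      rw [add_one_mul r (ℓ ^ j), ← add_assoc] at hy ⊢
      have hprev := ih (by omega)
      have hlast := cascade_add_pow_le hℓ (Nat.lt_succ_iff.2 hj) hy
      linarith
  case add =>
    intro f g _ _ hf hg y hy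
    rw [eval_add, ← add_assoc] at hy ⊢
    have := hf y (by omega)
    have := hg (y + f.eval ℓ) hy
    rw [derivative_add, eval_add]
    omega

/-- The evaluation of `f` at `ℓ` is a positive number of points, and the derivative of `f` at `ℓ`
is at most the half edge perimeter that the cascade function assigns to it in dimension `d`. -/
def DerivLeCascade (ℓ d : ℕ) (f : ℤ[X]) : Prop :=
  ∃ n : ℕ, 0 < n ∧ f.eval (ℓ : ℤ) = n ∧ f.derivative.eval (ℓ : ℤ) ≤ cascade d n

theorem eval_map_natCast (a : ℕ[X]) (x : ℕ) :
    (a.map (Nat.castRingHom ℤ)).eval (x : ℤ) = a.eval x :=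
  eval_natCast_map (Nat.castRingHom ℤ) a x

theorem DerivLeCascade.add_natCast {ℓ d : ℕ} {f : ℤ[X]} {a : ℕ[X]}
    (hf : DerivLeCascade ℓ (d + 1) f) (hℓ : 0 < ℓ) (ha : a.natDegree ≤ d)
    (hle : (f + a.map (Nat.castRingHom ℤ)).eval (ℓ : ℤ) ≤ ℓ ^ (d + 1)) :
    DerivLeCascade ℓ (d + 1) (f + a.map (Nat.castRingHom ℤ)) := by
  obtain ⟨n, hn, hfn, hfd⟩ := hf
  rw [eval_add, eval_map_natCast, hfn] at hle
  refine ⟨n + a.eval ℓ, by omega, by rw [eval_add, eval_map_natCast, hfn, Nat.cast_add], ?_⟩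
  have := cascade_add_derivative_le hℓ ha (y := n) (by exact_mod_cast hle)
  rw [derivative_add, eval_add, derivative_map, eval_map_natCast]
  zify at this
  linarith

theorem DerivLeCascade.shiftedBalPoly_add {ℓ d N : ℕ} {g : ℤ[X]} (hg : DerivLeCascade ℓ d g)
    (hle : g.eval (ℓ : ℤ) ≤ balVol d (facetSum d N)) :
    DerivLeCascade ℓ (d + 1) (shiftedBalPoly ℓ (d + 1) N + g) := by
  obtain ⟨n, hn, hgn, hgd⟩ := hg
  rw [hgn, Nat.cast_le] at hle
  refine ⟨balVol (d + 1) N + n, by omega, ?_, ?_⟩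
  · rw [eval_add, eval_shiftedBalPoly, hgn, Nat.cast_add]
  · rw [derivative_add, eval_add, eval_derivative_shiftedBalPoly, cascade_balVol_add_of_pos hn hle]
    push_cast
    linarith

/-- The coefficients of `h`, with the negative ones replaced by `0`. -/
noncomputable def truncNeg (h : ℤ[X]) : ℕ[X] := ∑ i ∈ h.support, monomial i (h.coeff i).toNat

theorem coeff_truncNeg (h : ℤ[X]) (i : ℕ) : (truncNeg h).coeff i = (h.coeff i).toNat := by
  simp +contextual [truncNeg, coeff_monomial]

theorem natDegree_truncNeg_le (h : ℤ[X]) : (truncNeg h).natDegree ≤ h.natDegree :=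
  natDegree_le_iff_coeff_eq_zero.2 fun i hi => by
    rw [coeff_truncNeg, coeff_eq_zero_of_natDegree_lt hi, Int.toNat_zero]

theorem truncNeg_sub_truncNeg_neg (h : ℤ[X]) :
    (truncNeg h).map (Nat.castRingHom ℤ) - (truncNeg (-h)).map (Nat.castRingHom ℤ) = h := by
  ext i
  simp [coeff_truncNeg]

end DerivativeBound

section SliceRecursion

/-- The bound of the half edge perimeter by the cascade function for all volume polynomials
`X ^ (k + 1) - h` of degree `k + 1`, where `M` bounds the leading coefficient of `h` and binomial
coefficients of `K` bound the lower ones. -/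
def CascadeDerivBound (ℓ k M K : ℕ) : Prop :=
  ∀ h : ℤ[X], h.natDegree ≤ k → h.coeff k ≤ M →
    (∀ j m, j + m + 1 = k → h.coeff j ≤ K.choose (m + 2)) → 0 ≤ h.eval (ℓ : ℤ) →
    DerivLeCascade ℓ (k + 1) (X ^ (k + 1) - h)

theorem cascadeDerivBound_of_natCast {ℓ k M K : ℕ} (hℓ : 0 < ℓ)
    (H : ∀ q : ℕ[X], q.natDegree ≤ k → q.coeff k ≤ M →
      (∀ j m, j + m + 1 = k → q.coeff j ≤ K.choose (m + 2)) →
      DerivLeCascade ℓ (k + 1) (X ^ (k + 1) - q.map (Nat.castRingHom ℤ))) :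
    CascadeDerivBound ℓ k M K := by
  intro h hdeg hlead hlow heval
  have hq := H (truncNeg h) ((natDegree_truncNeg_le h).trans hdeg)
    (by rw [coeff_truncNeg]; omega)
    (fun j m hjm => by have := hlow j m hjm; rw [coeff_truncNeg]; omega)
  have hneg : (truncNeg (-h)).natDegree ≤ k :=
    (natDegree_truncNeg_le _).trans (by rwa [natDegree_neg])
  have hadd := hq.add_natCast hℓ hneg
  rw [sub_add, truncNeg_sub_truncNeg_neg, eval_sub, eval_pow, eval_X] at hadd
  exact hadd (by linarith)

theorem cascadeDerivBound_zero {ℓ M K : ℕ} (h : M < ℓ) : CascadeDerivBound ℓ 0 M K := by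
  refine cascadeDerivBound_of_natCast (by omega) fun q hdeg hlead _ => ?_
  rw [eq_C_of_natDegree_le_zero hdeg]
  generalize q.coeff 0 = a at hlead
  refine ⟨ℓ - a, by omega, by simp; omega, ?_⟩
  have hcascade := cascade_pow (d := 1) (show 0 < ℓ - a by omega)
  rw [pow_one] at hcascade
  simp [hcascade]

theorem coeff_mul_pow_le_eval (q : ℕ[X]) (i x : ℕ) : q.coeff i * x ^ i ≤ q.eval x := by
  rw [eval_eq_sum, sum_def]
  by_cases hi : i ∈ q.support
  · exact single_le_sum (f := fun i => q.coeff i * x ^ i) (fun _ _ => Nat.zero_le _) hi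
  · simp [notMem_support_iff.1 hi]

/-- What is missing from a facet of volume `X ^ d` after the balanced box with side sum `N` is split
off from a configuration of volume `X ^ (d + 1) - q`. -/
noncomputable def facetRemainder (ℓ d N : ℕ) (q : ℕ[X]) : ℤ[X] :=
  X ^ d - X ^ (d + 1) + q.map (Nat.castRingHom ℤ) + shiftedBalPoly ℓ (d + 1) N

theorem shiftedBalPoly_add_pow_sub_facetRemainder (ℓ d N : ℕ) (q : ℕ[X]) :
    shiftedBalPoly ℓ (d + 1) N + (X ^ d - facetRemainder ℓ d N q) =
      X ^ (d + 1) - q.map (Nat.castRingHom ℤ) := by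
  rw [facetRemainder]
  ring

section

variable {ℓ d N : ℕ} {q : ℕ[X]} (hN : N + (q.coeff d + 1) = (d + 1) * ℓ)

include hN

theorem natDegree_facetRemainder_le {k : ℕ} (hk : d = k + 1) (hq : q.natDegree ≤ d) :
    (facetRemainder ℓ d N q).natDegree ≤ k := by
  refine natDegree_le_iff_coeff_eq_zero.2 fun i hi => ?_
  have hqi (hdi : d < i) : q.coeff i = 0 := coeff_eq_zero_of_natDegree_lt (hq.trans_lt hdi)
  simp only [facetRemainder, coeff_add, coeff_sub, coeff_X_pow, coeff_map]
  obtain rfl | rfl | hi : i = d ∨ i = d + 1 ∨ d + 1 < i := by omega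
  · simp [coeff_shiftedBalPoly_succ hN]
    ring
  · simp [hqi, coeff_shiftedBalPoly_self]
  · have hbox : (shiftedBalPoly ℓ (d + 1) N).coeff i = 0 :=
      coeff_eq_zero_of_natDegree_lt (by rwa [natDegree_shiftedBalPoly])
    simp [hqi (by omega), hbox, show i ≠ d by omega, show i ≠ d + 1 by omega]

theorem coeff_facetRemainder_le {j m M K : ℕ} (hjm : j + (m + 1) = d) (hM : q.coeff d ≤ M)
    (hK : q.coeff j ≤ K.choose (m + 2)) :
    (facetRemainder ℓ d N q).coeff j ≤ ((M + 1).choose 2 + K.choose 2).choose (m + 1) := by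
  have hbox : (shiftedBalPoly ℓ (d + 1) N).coeff j ≤ (M + 1).choose (m + 2) :=
    (le_abs_self _).trans <| (abs_coeff_shiftedBalPoly_le hN (by omega)).trans <|
      mod_cast Nat.choose_le_choose _ (Nat.succ_le_succ hM)
  have := choose_le_choose_choose_two (M + 1) m
  have := choose_le_choose_choose_two K m
  have := choose_add_choose_le ((M + 1).choose 2) (K.choose 2) m
  simp only [facetRemainder, coeff_add, coeff_sub, coeff_X_pow, coeff_map, if_neg,
    show j ≠ d by omega, show j ≠ d + 1 by omega, not_false_eq_true, Nat.coe_castRingHom]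
  omega

theorem eval_facetRemainder_nonneg : 0 ≤ (facetRemainder ℓ d N q).eval (ℓ : ℤ) := by
  have hvol := pow_le_balVol_add hN
  have hlead := coeff_mul_pow_le_eval q d ℓ
  rw [Nat.succ_mul] at hvol
  simp only [facetRemainder, eval_add, eval_sub, eval_pow, eval_X, eval_shiftedBalPoly,
    eval_map_natCast]
  zify at hvol hlead
  linarith

theorem pow_sub_eval_facetRemainder_le :
    (X ^ d - facetRemainder ℓ d N q : ℤ[X]).eval (ℓ : ℤ) ≤ balVol d (facetSum d N) := by
  have hvol := pow_le_balVol_add (N := N + 1) (c := q.coeff d) (b := ℓ) (d := d) (by linarith)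
  have hlead := coeff_mul_pow_le_eval q d ℓ
  rw [balVol_succ_succ_eq_add] at hvol
  simp only [facetRemainder, eval_add, eval_sub, eval_pow, eval_X, eval_shiftedBalPoly,
    eval_map_natCast]
  zify at hvol hlead
  linarith

end

theorem CascadeDerivBound.succ {ℓ k M K K' : ℕ} (hM : M < ℓ)
    (hK' : (M + 1).choose 2 + K.choose 2 = K') (H : CascadeDerivBound ℓ k K' K') :
    CascadeDerivBound ℓ (k + 1) M K := by
  refine cascadeDerivBound_of_natCast (by omega) fun q hdeg hlead hlow => ?_
  obtain ⟨N, hN⟩ : ∃ N, N + (q.coeff (k + 1) + 1) = (k + 1 + 1) * ℓ :=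
    ⟨_, Nat.sub_add_cancel (by nlinarith)⟩
  have hcoeff (j m : ℕ) (hjm : j + m = k) :
      (facetRemainder ℓ (k + 1) N q).coeff j ≤ K'.choose (m + 1) :=
    hK' ▸ coeff_facetRemainder_le hN (by omega) hlead (hlow j m (by omega))
  have hfacet := H _ (natDegree_facetRemainder_le hN rfl hdeg)
    (by simpa using hcoeff k 0 rfl) (fun j m hjm => hcoeff j (m + 1) (by omega))
    (eval_facetRemainder_nonneg hN)
  have hbox := hfacet.shiftedBalPoly_add (pow_sub_eval_facetRemainder_le hN)
  rwa [shiftedBalPoly_add_pow_sub_facetRemainder] at hbox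

theorem cascadeDerivBound_of_pow_lt {ℓ k M : ℕ} (h : M ^ 2 ^ k < ℓ) :
    CascadeDerivBound ℓ k M M := by
  induction k generalizing M with
  | zero => exact cascadeDerivBound_zero (by simpa using h)
  | succ k ih =>
    refine .succ ((Nat.le_self_pow (by positivity) M).trans_lt h)
      (choose_two_succ_add_choose_two M) (ih ?_)
    rwa [← pow_mul, ← pow_succ']

theorem cascadeDerivBound_of_pow_le {ℓ e p : ℕ} (hpℓ : p < ℓ) (h : p ^ 2 ^ e ≤ ℓ) :
    CascadeDerivBound ℓ e p 0 := by
  cases e with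
  | zero => exact cascadeDerivBound_zero hpℓ
  | succ k =>
    refine .succ hpℓ rfl (cascadeDerivBound_of_pow_lt ?_)
    rw [Nat.choose_zero_succ, add_zero]
    rcases lt_or_ge p 2 with hp | hp
    · interval_cases p <;> simpa using hpℓ
    · have hlt : (p + 1).choose 2 < p ^ 2 := by
        have := choose_two_succ_add_choose_two p
        have := Nat.choose_pos hp
        omega
      rw [pow_succ', pow_mul] at h
      exact (Nat.pow_lt_pow_left hlt (by positivity)).trans_le h

theorem pow_add_mul_le_cascade {ℓ e p : ℕ} (hpℓ : p < ℓ) (h : p ^ 2 ^ e ≤ ℓ) :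
    ℓ ^ e + e * ((ℓ - p) * ℓ ^ (e - 1)) ≤ cascade (e + 1) ((ℓ - p) * ℓ ^ e) := by
  obtain ⟨a, rfl⟩ := Nat.exists_eq_add_of_le' hpℓ.le
  obtain ⟨n, -, hn, hderiv⟩ := cascadeDerivBound_of_pow_le hpℓ h (C (p : ℤ) * X ^ e)
    (natDegree_C_mul_X_pow_le _ _) (by simp)
    (fun j m hjm => by simp [coeff_X_pow, show j ≠ e by omega])
    (by rw [eval_mul, eval_C, eval_pow, eval_X]; positivity)
  obtain rfl : n = a * (a + p) ^ e := by
    rw [eval_sub, eval_mul, eval_C, eval_pow, eval_pow, eval_X] at hn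
    zify
    rw [← hn, Nat.cast_add]
    ring
  rw [Nat.add_sub_cancel]
  zify
  refine le_of_eq_of_le ?_ hderiv
  rcases e with - | e
  · simp
  simp only [derivative_sub, derivative_X_pow, derivative_C_mul_X_pow, eval_sub, eval_mul, eval_C,
    eval_pow, eval_X]
  push_cast
  ring

end SliceRecursion

section Boxes

theorem hParam_pow (ℓ d : ℕ) : hParam ℓ (d + 1) ^ 2 ^ d = ℓ := by
  have hexp : (2 : ℝ) ^ (1 - ((d + 1 : ℕ) : ℝ)) * ((2 ^ d : ℕ) : ℝ) = 1 := by
    rw [Nat.cast_pow, Nat.cast_ofNat, ← Real.rpow_natCast 2 d, ← Real.rpow_add two_pos]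
    simp
  rw [hParam, ← Real.rpow_natCast, ← Real.rpow_mul ℓ.cast_nonneg, hexp, Real.rpow_one]

theorem pow_le_of_le_floor_hParam {ℓ d p : ℕ} (hp : p ≤ ⌊hParam ℓ (d + 1)⌋₊) :
    p ^ 2 ^ d ≤ ℓ := by
  have hp' : (p : ℝ) ≤ hParam ℓ (d + 1) :=
    (Nat.le_floor_iff (Real.rpow_nonneg ℓ.cast_nonneg _)).1 hp
  have hpow := pow_le_pow_left₀ p.cast_nonneg hp' (2 ^ d)
  rw [hParam_pow] at hpow
  exact_mod_cast hpow

theorem prod_X_add_C_card_side (ℓ e p : ℕ) :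
    ∏ j : Fin (e + 1), (X + C #(Icc (1 : ℤ) (if (j : ℕ) = 0 then (ℓ : ℤ) - p else ℓ))) =
      (X + C (ℓ - p)) * (X + C ℓ) ^ e := by
  simp [Fin.prod_univ_succ]

theorem card_boxP (ℓ e p : ℕ) : #(boxP ℓ (e + 1) p) = (ℓ - p) * ℓ ^ e := by
  simp [boxP, Fin.prod_univ_succ]

theorem edgePerimeter_boxP_le (ℓ e p : ℕ) :
    edgePerimeter (boxP ℓ (e + 1) p) ≤ 2 * (ℓ ^ e + e * ((ℓ - p) * ℓ ^ (e - 1))) := by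
  refine (edgePerimeter_piFinset_Icc_le _ _).trans_eq ?_
  rw [prod_X_add_C_card_side, add_mul, coeff_add, coeff_X_mul, coeff_C_mul, coeff_X_add_C_pow,
    coeff_X_add_C_pow]
  simp
  ring

theorem isEIPMinimizer_boxP_of_pow_le {ℓ e p : ℕ} (h : p ^ 2 ^ e ≤ ℓ) :
    IsEIPMinimizer (boxP ℓ (e + 1) p) := by
  rcases lt_or_ge p ℓ with hpℓ | hpℓ
  · refine isEIPMinimizer_of_le_cascade ((edgePerimeter_boxP_le ℓ e p).trans ?_)
    rw [card_boxP]
    exact Nat.mul_le_mul_left 2 (pow_add_mul_le_cascade hpℓ h)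
  · have hcard := card_boxP ℓ e p
    rw [Nat.sub_eq_zero_of_le hpℓ, zero_mul, card_eq_zero] at hcard
    exact Or.inl hcard

end Boxes

theorem lemma3p5 (d : ℕ) (hd : 2 ≤ d) (ℓ p : ℕ) (hp : p ≤ ⌊hParam ℓ d⌋₊) :
    IsEIPMinimizer (boxP ℓ d p) := by
  obtain ⟨e, rfl⟩ : ∃ e, d = e + 1 := Nat.exists_eq_succ_of_ne_zero (by omega)
  exact isEIPMinimizer_boxP_of_pow_le (pow_le_of_le_floor_hParam hp)
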